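/- Let $S$ be the set of positive integers that are not congruent to $2$ modulo $4$ and are either prime or squarefull (a positive integer is squarefull if every prime factor occurs in it with exponent at least $2$). For $X\in\mathbb{R}_{>0}$ put $$f(X)=\sum_{\substack{N\le X\\ N\in S}}\frac{\phi(N)}{N},$$ where $\phi$ is Euler's totient function. For $x\in\mathbb{R}_{>0}$ let $\lceil x\rceil^{\mathfrak p}$ be the smallest prime that is greater than or equal to $x$. For a positive integer $N$ let $\mathcal{D}_+(N)$ (resp. $\mathcal{D}_-(N)$) be the set of primitive Dirichlet characters $\chi$ mod $N$ with $\chi(-1)=1$ (resp. $\chi(-1)=-1$), and let $\tau(\chi)=\sum_{b=1}^{N}\chi(b)e^{2\pi i b/N}$ be the Gauss sum. For $y,X\in\mathbb{R}_{>0}$ and $\delta\in(0,1)$ define (whenever $f(X+X^\delta)\neq f(X)$) $$\widetilde{Q}^S_{\pm}(y,X,\delta)=\frac{1}{f(X+X^\delta)-f(X)}\sum_{\substack{N\in[X,X+X^\delta]\\ N\in S}}\ \sum_{\chi\in\mathcal{D}_\pm(N)}\frac{\chi(\lceil yX\rceil^{\mathfrak p})}{\tau(\chi)}.$$ Assume the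 Riemann hypothesis. If $\delta\in(\tfrac12,1)$ and $y\in\mathbb{R}_{>0}$, then, as $X\to\infty$ through the real numbers, $$\lim_{X\to\infty}\widetilde{Q}^S_{+}(y,X,\delta)=\cos(2\pi y)\qquad\text{and}\qquad \lim_{X\to\infty}\widetilde{Q}^S_{-}(y,X,\delta)=-i\sin(2\pi y).$$ -/

import Mathlib

open Filter Topology

noncomputable section

namespace DirichletMurmuration

/-- The smallest prime that is bigger than or equal to the real number `x`. -/
def nextPrime (x : ℝ) : ℕ := sInf {p : ℕ | p.Prime ∧ x ≤ (p : ℝ)}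

/-- The Gauss sum `τ(χ) = ∑_{b=1}^{N} χ(b) e^{2πib/N}` of a Dirichlet character mod `N`. -/
def tau {N : ℕ} (χ : DirichletCharacter ℂ N) : ℂ :=
  ∑ b ∈ Finset.Icc 1 N, χ (b : ZMod N) * Complex.exp (2 * Real.pi * Complex.I * b / N)

/-- The set of primitive even Dirichlet characters mod `N`. -/
def evenPrimitive (N : ℕ) : Set (DirichletCharacter ℂ N) := {χ | χ.IsPrimitive ∧ χ.Even}

/-- The set of primitive odd Dirichlet characters mod `N`. -/
def oddPrimitive (N : ℕ) : Set (DirichletCharacter ℂ N) := {χ | χ.IsPrimitive ∧ χ.Odd}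

/-- A positive integer is squarefull if all its prime factors have exponent at least `2`. -/
def Squarefull (N : ℕ) : Prop := 0 < N ∧ ∀ p : ℕ, p.Prime → p ∣ N → p ^ 2 ∣ N

/-- The positive integers not congruent to `2` mod `4` that are either prime or squarefull. -/
def S : Set ℕ := {N | 0 < N ∧ ¬ N ≡ 2 [MOD 4] ∧ (N.Prime ∨ Squarefull N)}

open Classical in
/-- `f(X) = ∑_{N ≤ X, N ∈ S} φ(N)/N`. -/
def f (X : ℝ) : ℝ :=
  ∑ N ∈ (Finset.Icc 1 ⌊X⌋₊).filter (fun N => N ∈ S), (Nat.totient N : ℝ) / (N : ℝ)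

open Classical in
/-- The average over the conductors `N ∈ S ∩ [X, X + X^δ]` of the sums of `χ(p) / τ(χ)` over
`χ ∈ D N`, where `p` is the smallest prime `≥ yX`, normalized by `f(X + X^δ) - f(X)`.
It is used with `D = evenPrimitive` and with `D = oddPrimitive`. -/
def QS (D : (N : ℕ) → Set (DirichletCharacter ℂ N)) (y X δ : ℝ) : ℂ :=
  1 / ((f (X + X ^ δ) - f X : ℝ) : ℂ) *
    ∑ N ∈ (Finset.Icc ⌈X⌉₊ ⌊X + X ^ δ⌋₊).filter (fun N => N ∈ S),
      ∑ᶠ χ ∈ D N, χ (nextPrime (y * X) : ZMod N) / tau χ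

end DirichletMurmuration

end

/-!
For `N` prime or squarefull, an imprimitive character mod `N` has Gauss sum zero, except for the
principal character of a prime modulus, whose Gauss sum is `-1`. The sum of `χ(q) / τ(χ)` over
the primitive characters of a given parity is therefore, up to `O(1/N)`, a sum over all characters
of that parity, which orthogonality evaluates as `φ(N)/N` times `cos (2πq/N)` or
`-i sin (2πq/N)`. In the average `q = nextPrime (y * X)`, and `q/N → y` uniformly over the window
because consecutive primes are asymptotically equal; that follows from the nonvanishing of `ζ` on
`Re s = 1` by Fejér-kernel smoothing of `∑ Λ(n) n⁻ˢ`. The `O(1)` total error is negligible since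
the squares alone give `f(X + X^δ) - f(X) ≫ X^(δ - 1/2) / log X`, which is where `δ > 1/2` enters.
-/

namespace DirichletMurmuration

section GaussSums

lemma isPrimitive_addChar_inv {R R' : Type*} [CommRing R] [CommMonoid R'] {e : AddChar R R'}
    (he : e.IsPrimitive) : e⁻¹.IsPrimitive := fun a ha => by
  rw [AddChar.inv_mulShift, AddChar.mulShift_mulShift]
  exact he (by simpa using ha)

lemma gaussSum_eq_zero_of_map_add {R R' : Type*} [CommRing R] [Fintype R] [CommRing R']
    [IsDomain R'] {χ : MulChar R R'} {e : AddChar R R'} {m : R} (hχ : ∀ b, χ (b + m) = χ b)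
    (he : e m ≠ 1) : gaussSum χ e = 0 := by
  have hshift : gaussSum χ e = gaussSum χ e * e m := by
    conv_lhs => rw [gaussSum, ← Equiv.sum_comp (Equiv.addRight m)]
    simp only [gaussSum, Finset.sum_mul, Equiv.coe_addRight, hχ, AddChar.map_add_eq_mul, mul_assoc]
  exact eq_zero_of_mul_eq_self_right he hshift.symm

variable {N : ℕ}

lemma tau_eq_gaussSum [NeZero N] (χ : DirichletCharacter ℂ N) :
    tau χ = gaussSum χ ZMod.stdAddChar := by
  have hsurj : Set.SurjOn (fun b : ℕ => (b : ZMod N)) (Finset.Icc 1 N)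
      (Finset.univ : Finset (ZMod N)) := fun x _ => by
    rcases Nat.eq_zero_or_pos x.val with hx | hx
    · exact ⟨N, by simpa using NeZero.one_le, by simp [(ZMod.val_eq_zero x).1 hx]⟩
    · exact ⟨x.val, by simpa using ⟨hx, (ZMod.val_lt x).le⟩, by simp⟩
  refine Finset.sum_nbij (fun b : ℕ => (b : ZMod N)) (fun _ _ => Finset.mem_univ _)
    (Finset.injOn_of_surjOn_of_card_le _ (fun _ _ => Finset.mem_univ _) hsurj (by simp)) hsurj
    fun b _ => ?_
  have hb := ZMod.stdAddChar_coe (N := N) b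
  push_cast at hb
  rw [hb]

lemma gaussSum_mul_gaussSum_inv_of_isPrimitive [NeZero N] {R : Type*} [CommRing R] [IsDomain R]
    {χ : DirichletCharacter R N} (hχ : χ.IsPrimitive) {e : AddChar (ZMod N) R}
    (he : e.IsPrimitive) : gaussSum χ e * gaussSum χ⁻¹ e⁻¹ = N := by
  calc gaussSum χ e * gaussSum χ⁻¹ e⁻¹
      = ∑ b, gaussSum χ (e.mulShift b) * e (-b) := by
        rw [gaussSum.eq_def χ⁻¹, Finset.mul_sum]
        refine Finset.sum_congr rfl fun b _ => ?_
        rw [gaussSum_mulShift_of_isPrimitive e hχ, AddChar.inv_apply]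
        ring
    _ = ∑ b, ∑ a, χ a * e (b * (a - 1)) := by
        refine Finset.sum_congr rfl fun b _ => ?_
        rw [gaussSum, Finset.sum_mul]
        refine Finset.sum_congr rfl fun a _ => ?_
        rw [AddChar.mulShift_apply, mul_assoc, ← AddChar.map_add_eq_mul, mul_sub_one,
          sub_eq_add_neg]
    _ = N := by
        rw [Finset.sum_comm]
        simp_rw [← Finset.mul_sum, AddChar.sum_mulShift _ he, sub_eq_zero]
        simp

lemma map_add_natCast_of_factorsThrough {R : Type*} [CommMonoidWithZero R]
    {χ : DirichletCharacter R N} {M : ℕ} (hχ : χ.FactorsThrough M) (hM : N ∣ M ^ 2)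
    (b : ZMod N) : χ (b + M) = χ b := by
  have hnil : IsNilpotent (M : ZMod N) :=
    ⟨2, by rw [← Nat.cast_pow, ZMod.natCast_eq_zero_iff]; exact hM⟩
  have hunit : IsUnit (b + M) ↔ IsUnit b :=
    ⟨fun h => by simpa using hnil.neg.isUnit_add_left_of_commute h (Commute.all _ _),
      fun h => hnil.isUnit_add_left_of_commute h (Commute.all _ _)⟩
  obtain ⟨hdvd, χ₀, rfl⟩ := hχ
  by_cases hb : IsUnit b
  · obtain ⟨u, rfl⟩ := hb
    obtain ⟨v, hv⟩ := hunit.2 u.isUnit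
    rw [← hv, DirichletCharacter.changeLevel_eq_cast_of_dvd,
      DirichletCharacter.changeLevel_eq_cast_of_dvd, hv, ZMod.cast_add hdvd,
      ZMod.cast_natCast hdvd, ZMod.natCast_self, add_zero]
  · rw [MulChar.map_nonunit _ hb, MulChar.map_nonunit _ (mt hunit.1 hb)]

lemma eq_one_of_prime_of_not_isPrimitive [NeZero N] {R : Type*} [CommMonoidWithZero R]
    {χ : DirichletCharacter R N} (hN : N.Prime) (hχ : ¬ χ.IsPrimitive) : χ = 1 := by
  rw [DirichletCharacter.eq_one_iff_conductor_eq_one]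
  exact ((Nat.dvd_prime hN).1 χ.conductor_dvd_level).resolve_right hχ

lemma Squarefull.exists_dvd_sq (hN : Squarefull N) {d : ℕ} (hd : d ∣ N) (hdN : d ≠ N) :
    ∃ M, d ∣ M ∧ M ∣ N ∧ M ≠ N ∧ N ∣ M ^ 2 := by
  obtain ⟨k, rfl⟩ := hd
  obtain ⟨p, hp, l, rfl⟩ := Nat.exists_prime_and_dvd (n := k) (by rintro rfl; simp at hdN)
  have hpos : 0 < p * (d * l) := by have := hN.1; rwa [mul_left_comm] at this
  obtain ⟨r, hr⟩ := hN.2 p hp ⟨d * l, by ring⟩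
  have hM : d * l = p * r := Nat.eq_of_mul_eq_mul_left hp.pos (by linear_combination hr)
  refine ⟨d * l, ⟨l, rfl⟩, ⟨p, by ring⟩, fun h => ?_, ⟨r, ?_⟩⟩
  · exact hp.one_lt.ne' (Nat.eq_of_mul_eq_mul_right (Nat.pos_of_mul_pos_left hpos)
      (by linear_combination -h))
  · linear_combination (d * l) * hM

variable [NeZero N] {R : Type*} [CommRing R] [IsDomain R] {χ : DirichletCharacter R N}
  {e : AddChar (ZMod N) R}

lemma gaussSum_eq_zero_of_squarefull (hN : Squarefull N) (hχ : ¬ χ.IsPrimitive)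
    (he : e.IsPrimitive) : gaussSum χ e = 0 := by
  obtain ⟨M, hdM, hMN, hne, hsq⟩ := hN.exists_dvd_sq χ.conductor_dvd_level hχ
  refine gaussSum_eq_zero_of_map_add (m := (M : ZMod N)) (map_add_natCast_of_factorsThrough
    (χ.factorsThrough_conductor.mono χ hdM hMN) hsq) ?_
  rw [Ne, he.zmod_char_eq_one_iff, ZMod.natCast_eq_zero_iff]
  exact fun h => hne (Nat.dvd_antisymm hMN h)

lemma gaussSum_one_of_prime (hN : N.Prime) (he : e.IsPrimitive) :
    gaussSum (1 : DirichletCharacter R N) e = -1 := by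
  have : Fact N.Prime := ⟨hN⟩
  exact gaussSum_one_left (by simpa using he one_ne_zero)

end GaussSums

section CharacterSums

lemma ite_map_neg_one_eq {N : ℕ} {s : ℂ} (hs : s = 1 ∨ s = -1) (χ : DirichletCharacter ℂ N) :
    (if χ (-1) = s then 1 else 0) = (1 + s * χ (-1)) / 2 := by
  have hsq : χ (-1) * χ (-1) = 1 := by rw [← map_mul, neg_one_mul, neg_neg, map_one]
  rcases mul_self_eq_one_iff.1 hsq with h | h <;> rcases hs with rfl | rfl <;> rw [h] <;> norm_num

variable {N : ℕ} [NeZero N]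

lemma sum_mul_gaussSum_inv {q : ZMod N} (hq : IsUnit q) (e : AddChar (ZMod N) ℂ) :
    ∑ χ : DirichletCharacter ℂ N, χ q * gaussSum χ⁻¹ e = N.totient * e q := by
  have horth (b : ZMod N) : ∑ χ : DirichletCharacter ℂ N, χ q * (χ⁻¹ b * e b) =
      (if b = q then (N.totient : ℂ) else 0) * e b := by
    by_cases hb : IsUnit b
    · rw [← DirichletCharacter.sum_char_inv_mul_char_eq ℂ hb q, Finset.sum_mul]
      obtain ⟨v, rfl⟩ := hb
      refine Finset.sum_congr rfl fun χ _ => ?_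
      rw [MulChar.inv_apply, Ring.inverse_unit, ZMod.inv_coe_unit]
      ring
    · rw [if_neg fun h : b = q => hb (h ▸ hq), zero_mul]
      exact Finset.sum_eq_zero fun χ _ => by rw [MulChar.map_nonunit _ hb, zero_mul, mul_zero]
  simp_rw [gaussSum, Finset.mul_sum]
  rw [Finset.sum_comm]
  simp [horth]

/-- The primitive Dirichlet characters `χ` mod `N` with `χ(-1) = s`, so that the two parities can
be treated together. -/
def signPrimitive (s : ℂ) (N : ℕ) : Set (DirichletCharacter ℂ N) :=
  {χ | χ.IsPrimitive ∧ χ (-1) = s}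

/-- The inner sum `∑ χ(q) / τ(χ)` of a murmuration average, over the primitive characters `χ`
mod `N` with `χ(-1) = s`. -/
noncomputable def signSum (s : ℂ) (q N : ℕ) : ℂ :=
  ∑ᶠ χ ∈ signPrimitive s N, χ q / tau χ

/-- The limiting density of the murmurations of the characters with `χ(-1) = s`. -/
noncomputable def density (s : ℂ) (u : ℝ) : ℂ :=
  (Complex.exp (-(2 * Real.pi * Complex.I * u)) + s * Complex.exp (2 * Real.pi * Complex.I * u)) / 2

lemma density_one (u : ℝ) : density 1 u = (Real.cos (2 * Real.pi * u) : ℂ) := by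
  rw [density, Complex.ofReal_cos, Complex.cos]
  push_cast
  ring_nf

lemma density_neg_one (u : ℝ) :
    density (-1) u = -Complex.I * (Real.sin (2 * Real.pi * u) : ℂ) := by
  rw [density, Complex.ofReal_sin, Complex.sin]
  push_cast
  ring_nf
  rw [Complex.I_sq]
  ring

lemma continuous_density (s : ℂ) : Continuous (density s) := by
  unfold density
  fun_prop

lemma norm_density_le {s : ℂ} (hs : ‖s‖ ≤ 1) (u : ℝ) : ‖density s u‖ ≤ 1 := by
  have hneg : ‖Complex.exp (-(2 * Real.pi * Complex.I * u))‖ = 1 := by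
    simpa [mul_right_comm] using Complex.norm_exp_ofReal_mul_I (-(2 * Real.pi * u))
  have hpos : ‖Complex.exp (2 * Real.pi * Complex.I * u)‖ = 1 := by
    simpa [mul_right_comm] using Complex.norm_exp_ofReal_mul_I (2 * Real.pi * u)
  rw [density, norm_div, Complex.norm_ofNat, div_le_one two_pos]
  refine (norm_add_le _ _).trans ?_
  rw [norm_mul, hneg, hpos]
  linarith

lemma density_natCast_div (s : ℂ) (q : ℕ) :
    density s ((q : ℝ) / N) =
      (ZMod.stdAddChar (-(q : ZMod N)) + s * ZMod.stdAddChar (q : ZMod N)) / 2 := by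
  have hpos := ZMod.stdAddChar_coe (N := N) q
  have hneg := ZMod.stdAddChar_coe (N := N) (-q : ℤ)
  push_cast at hpos hneg
  rw [hpos, hneg, density]
  push_cast
  ring_nf

lemma sum_sign_mul_gaussSum_inv {s : ℂ} (hs : s = 1 ∨ s = -1) {q : ℕ} (hq : q.Coprime N) :
    ∑ χ : DirichletCharacter ℂ N with χ (-1) = s, χ q * gaussSum χ⁻¹ ZMod.stdAddChar⁻¹ =
      N.totient * density s ((q : ℝ) / N) := by
  have hu : IsUnit (q : ZMod N) := (ZMod.isUnit_iff_coprime q N).2 hq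
  have hpos := sum_mul_gaussSum_inv hu ZMod.stdAddChar⁻¹
  have hneg := sum_mul_gaussSum_inv hu.neg ZMod.stdAddChar⁻¹
  rw [AddChar.inv_apply] at hpos hneg
  rw [neg_neg] at hneg
  calc ∑ χ : DirichletCharacter ℂ N with χ (-1) = s, χ q * gaussSum χ⁻¹ ZMod.stdAddChar⁻¹
      = ∑ χ : DirichletCharacter ℂ N, (χ q * gaussSum χ⁻¹ ZMod.stdAddChar⁻¹ +
          s * (χ (-q) * gaussSum χ⁻¹ ZMod.stdAddChar⁻¹)) / 2 := by
        rw [Finset.sum_filter]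
        refine Finset.sum_congr rfl fun χ _ => ?_
        rw [← boole_mul, ite_map_neg_one_eq hs, ← neg_one_mul (q : ZMod N), map_mul]
        ring
    _ = N.totient * density s ((q : ℝ) / N) := by
        rw [← Finset.sum_div, Finset.sum_add_distrib, ← Finset.mul_sum, hpos, hneg,
          density_natCast_div]
        ring

lemma div_tau_eq_of_isPrimitive {χ : DirichletCharacter ℂ N} (hχ : χ.IsPrimitive) (z : ℂ) :
    z / tau χ = z * gaussSum χ⁻¹ ZMod.stdAddChar⁻¹ / N := by
  have hN : (N : ℂ) ≠ 0 := NeZero.ne _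
  have hmul := gaussSum_mul_gaussSum_inv_of_isPrimitive hχ (ZMod.isPrimitive_stdAddChar N)
  rw [tau_eq_gaussSum, div_eq_div_iff (fun h => hN (by rw [← hmul, h, zero_mul])) hN, ← hmul]
  ring

open Classical in
lemma signSum_eq_sum_mul_gaussSum_inv (s : ℂ) (q : ℕ) :
    signSum s q N =
      (∑ χ : DirichletCharacter ℂ N with χ (-1) = s ∧ χ.IsPrimitive,
        χ q * gaussSum χ⁻¹ ZMod.stdAddChar⁻¹) / N := by
  rw [signSum, Finset.sum_div, finsum_mem_eq_finite_toFinset_sum _ (Set.toFinite _)]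
  refine Finset.sum_congr (by ext χ; simp [signPrimitive, and_comm]) fun χ hχ => ?_
  exact div_tau_eq_of_isPrimitive (Finset.mem_filter.1 hχ).2.2 _

lemma norm_gaussSum_inv_le_of_not_isPrimitive (hN : N.Prime ∨ Squarefull N)
    {χ : DirichletCharacter ℂ N} (hχ : ¬ χ.IsPrimitive) {e : AddChar (ZMod N) ℂ}
    (he : e.IsPrimitive) : ‖gaussSum χ⁻¹ e‖ ≤ if χ = 1 then 1 else 0 := by
  have hχ' : ¬ χ⁻¹.IsPrimitive := by
    rwa [DirichletCharacter.isPrimitive_def, DirichletCharacter.conductor_inv]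
  rcases hN with hN | hN
  · rw [eq_one_of_prime_of_not_isPrimitive hN hχ, inv_one, gaussSum_one_of_prime hN he]
    simp
  · rw [gaussSum_eq_zero_of_squarefull hN hχ' he]
    split_ifs <;> simp

lemma norm_signSum_sub_le (hN : N.Prime ∨ Squarefull N) {q : ℕ} (hq : q.Coprime N)
    {s : ℂ} (hs : s = 1 ∨ s = -1) :
    ‖signSum s q N - N.totient / N * density s ((q : ℝ) / N)‖ ≤ 1 / N := by
  classical
  have he := isPrimitive_addChar_inv (ZMod.isPrimitive_stdAddChar N)
  have himprimitive : ‖∑ χ : DirichletCharacter ℂ N with χ (-1) = s ∧ ¬ χ.IsPrimitive,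
      χ q * gaussSum χ⁻¹ ZMod.stdAddChar⁻¹‖ ≤ 1 := by
    calc ‖∑ χ : DirichletCharacter ℂ N with χ (-1) = s ∧ ¬ χ.IsPrimitive,
            χ q * gaussSum χ⁻¹ ZMod.stdAddChar⁻¹‖
        ≤ ∑ χ : DirichletCharacter ℂ N with χ (-1) = s ∧ ¬ χ.IsPrimitive,
            (if χ = 1 then (1 : ℝ) else 0) := by
          refine norm_sum_le_of_le _ fun χ hχ => ?_
          rw [norm_mul]
          exact (mul_le_of_le_one_left (norm_nonneg _) (χ.norm_le_one _)).trans
            (norm_gaussSum_inv_le_of_not_isPrimitive hN (Finset.mem_filter.1 hχ).2.2 he)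
      _ ≤ ∑ χ : DirichletCharacter ℂ N, (if χ = 1 then (1 : ℝ) else 0) :=
          Finset.sum_le_sum_of_subset_of_nonneg (Finset.filter_subset _ _)
            fun _ _ _ => by split_ifs <;> simp
      _ = 1 := by simp
  have hsplit := Finset.sum_filter_add_sum_filter_not
    {χ : DirichletCharacter ℂ N | χ (-1) = s} (fun χ => χ.IsPrimitive)
    fun χ => χ q * gaussSum χ⁻¹ ZMod.stdAddChar⁻¹
  rw [Finset.filter_filter, Finset.filter_filter, sum_sign_mul_gaussSum_inv hs hq] at hsplit
  rw [signSum_eq_sum_mul_gaussSum_inv, div_mul_eq_mul_div, ← sub_div, ← hsplit,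
    sub_add_cancel_left, norm_div, norm_neg, Complex.norm_natCast]
  gcongr

end CharacterSums

section Normalization

lemma inv_card_add_one_le_prod_one_sub_inv (s : Finset ℕ) (hs : ∀ p ∈ s, 2 ≤ p) :
    1 / ((s.card : ℝ) + 1) ≤ ∏ p ∈ s, (1 - (p : ℝ)⁻¹) := by
  induction s using Finset.induction_on_max with
  | empty => simp
  | insert a s hmax ih =>
    have hcard : (s.card : ℝ) + 2 ≤ a := by
      have hsub : s ⊆ Finset.Ico 2 a := fun p hp =>
        Finset.mem_Ico.2 ⟨hs p (Finset.mem_insert_of_mem hp), hmax p hp⟩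
      have hle := Finset.card_le_card hsub
      have ha := hs a (Finset.mem_insert_self a s)
      rw [Nat.card_Ico] at hle
      exact_mod_cast (show s.card + 2 ≤ a by lia)
    have hinv : (a : ℝ)⁻¹ ≤ ((s.card : ℝ) + 2)⁻¹ := by gcongr
    have hinv_le_one : (a : ℝ)⁻¹ ≤ 1 :=
      inv_le_one_of_one_le₀ (by linarith [s.card.cast_nonneg (α := ℝ)])
    rw [Finset.prod_insert fun h => lt_irrefl _ (hmax a h),
      Finset.card_insert_of_notMem fun h => lt_irrefl _ (hmax a h)]
    calc 1 / (((s.card + 1 : ℕ) : ℝ) + 1)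
        = (1 - ((s.card : ℝ) + 2)⁻¹) * (1 / ((s.card : ℝ) + 1)) := by
          push_cast
          field_simp
          ring
      _ ≤ (1 - (a : ℝ)⁻¹) * ∏ p ∈ s, (1 - (p : ℝ)⁻¹) := by
          gcongr
          exact ih fun p hp => hs p (Finset.mem_insert_of_mem hp)

lemma totient_div_eq_prod {n : ℕ} (hn : n ≠ 0) :
    (n.totient : ℝ) / n = ∏ p ∈ n.primeFactors, (1 - (p : ℝ)⁻¹) := by
  rw [div_eq_iff (by exact_mod_cast hn), mul_comm]
  simpa using congrArg ((↑) : ℚ → ℝ) n.totient_eq_mul_prod_factors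

lemma inv_logb_add_one_le_totient_div {n : ℕ} (hn : n ≠ 0) :
    1 / (Real.logb 2 n + 1) ≤ (n.totient : ℝ) / n := by
  have htwo : ∀ p ∈ n.primeFactors, 2 ≤ p := fun p hp => (Nat.prime_of_mem_primeFactors hp).two_le
  have hpow : 2 ^ n.primeFactors.card ≤ n :=
    (Finset.pow_card_le_prod _ _ _ htwo).trans
      (Nat.le_of_dvd (Nat.pos_of_ne_zero hn) (Nat.prod_primeFactors_dvd n))
  have hcard : (n.primeFactors.card : ℝ) ≤ Real.logb 2 n := by
    rw [Real.le_logb_iff_rpow_le one_lt_two (by positivity), Real.rpow_natCast]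
    exact_mod_cast hpow
  rw [totient_div_eq_prod hn]
  refine le_trans ?_ (inv_card_add_one_le_prod_one_sub_inv _ htwo)
  gcongr

lemma sq_mem_S {n : ℕ} (hn : 0 < n) : n ^ 2 ∈ S := by
  refine ⟨by positivity, fun h => ?_, Or.inr ⟨by positivity, fun p hp h =>
    pow_dvd_pow_of_dvd (hp.dvd_of_dvd_pow h) 2⟩⟩
  have hlt : n % 4 < 4 := Nat.mod_lt _ (by norm_num)
  rw [Nat.ModEq, Nat.pow_mod] at h
  interval_cases n % 4 <;> simp at h

open Classical in
lemma f_sub_f {X Y : ℝ} (h : X ≤ Y) :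
    f Y - f X = ∑ N ∈ (Finset.Ioc ⌊X⌋₊ ⌊Y⌋₊).filter (fun N => N ∈ S), (N.totient : ℝ) / N := by
  unfold f
  simp only [Finset.sum_filter]
  rw [sub_eq_iff_eq_add', eq_comm]
  exact Finset.sum_Ioc_consecutive _ (Nat.zero_le _) (Nat.floor_mono h)

open Classical in
lemma sq_mem_filter_S {X Y : ℝ} {n : ℕ} (hn : n ∈ Finset.Ioc ⌊√X⌋₊ ⌊√Y⌋₊) :
    n ^ 2 ∈ (Finset.Ioc ⌊X⌋₊ ⌊Y⌋₊).filter (fun N => N ∈ S) := by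
  obtain ⟨hXn, hnY⟩ := Finset.mem_Ioc.1 hn
  have hn0 : 0 < n := Nat.zero_lt_of_lt hXn
  refine Finset.mem_filter.2 ⟨Finset.mem_Ioc.2 ⟨?_, ?_⟩, sq_mem_S hn0⟩
  · rw [Nat.floor_lt' (by positivity), Nat.cast_pow, ← Real.sqrt_lt' (by positivity)]
    exact Nat.lt_of_floor_lt hXn
  · rw [Nat.le_floor_iff' (by positivity), Nat.cast_pow, ← Real.le_sqrt' (by positivity)]
    exact (Nat.le_floor_iff' hn0.ne').1 hnY

lemma sqrt_sub_sqrt_div_logb_le {X Y : ℝ} (hX : 1 ≤ X) (h : X ≤ Y) :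
    (√Y - √X - 1) / (Real.logb 2 Y + 1) ≤ f Y - f X := by
  classical
  have hlogY : 0 ≤ Real.logb 2 Y := Real.logb_nonneg one_lt_two (hX.trans h)
  have hterm : ∀ N ∈ (Finset.Ioc ⌊X⌋₊ ⌊Y⌋₊).filter (fun N => N ∈ S),
      1 / (Real.logb 2 Y + 1) ≤ (N.totient : ℝ) / N := fun N hN => by
    obtain ⟨hXN, hNY⟩ := Finset.mem_Ioc.1 (Finset.mem_filter.1 hN).1
    have hN0 : N ≠ 0 := Nat.ne_zero_of_lt hXN
    refine le_trans ?_ (inv_logb_add_one_le_totient_div hN0)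
    have hlogN : 0 ≤ Real.logb 2 N :=
      Real.logb_nonneg one_lt_two (Nat.one_le_cast.2 (Nat.one_le_iff_ne_zero.2 hN0))
    gcongr
    · exact one_lt_two
    · exact (Nat.le_floor_iff' hN0).1 hNY
  have hcard : √Y - √X - 1 ≤ ((Finset.Ioc ⌊√X⌋₊ ⌊√Y⌋₊).card : ℝ) := by
    rw [Nat.card_Ioc, Nat.cast_sub (Nat.floor_mono (Real.sqrt_le_sqrt h))]
    linarith [Nat.lt_floor_add_one (√Y), Nat.floor_le (Real.sqrt_nonneg X)]
  have hsquares : (Finset.Ioc ⌊√X⌋₊ ⌊√Y⌋₊).card ≤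
      ((Finset.Ioc ⌊X⌋₊ ⌊Y⌋₊).filter (fun N => N ∈ S)).card :=
    Finset.card_le_card_of_injOn (· ^ 2) (fun _ hn => sq_mem_filter_S hn)
      (Nat.pow_left_injective two_ne_zero).injOn
  rw [f_sub_f h]
  calc (√Y - √X - 1) / (Real.logb 2 Y + 1)
      ≤ ((Finset.Ioc ⌊X⌋₊ ⌊Y⌋₊).filter (fun N => N ∈ S)).card * (1 / (Real.logb 2 Y + 1)) := by
        rw [mul_one_div]
        gcongr
        exact hcard.trans (by exact_mod_cast hsquares)
    _ ≤ _ := by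
        rw [← nsmul_eq_mul]
        exact Finset.card_nsmul_le_sum _ _ _ hterm

lemma div_three_mul_sqrt_le_sqrt_add_sub_sqrt {x h : ℝ} (hh : 0 ≤ h) (hx : h ≤ x) :
    h / (3 * √x) ≤ √(x + h) - √x := by
  rcases (hh.trans hx).eq_or_lt with rfl | hx0
  · simp
  have hle : √(x + h) ≤ 2 * √x := by
    rw [Real.sqrt_le_left (by positivity), mul_pow, Real.sq_sqrt hx0.le]
    linarith
  have hsub : 0 ≤ √(x + h) - √x := sub_nonneg.2 (Real.sqrt_le_sqrt (by linarith))
  rw [div_le_iff₀ (by positivity)]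
  calc h = (√(x + h) - √x) * (√(x + h) + √x) := by
        linear_combination Real.sq_sqrt hx0.le - Real.sq_sqrt (show 0 ≤ x + h by positivity)
    _ ≤ (√(x + h) - √x) * (3 * √x) := by
        gcongr
        linarith

lemma tendsto_rpow_div_logb_add_atTop {ε : ℝ} (hε : 0 < ε) (c : ℝ) :
    Tendsto (fun x : ℝ => x ^ ε / (Real.logb 2 x + c)) atTop atTop := by
  have hlittle : (fun x : ℝ => Real.logb 2 x + c) =o[atTop] fun x => x ^ ε := by
    refine Asymptotics.IsLittleO.add ?_ (Asymptotics.isLittleO_const_left.2 (Or.inr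
      (tendsto_norm_atTop_atTop.comp (tendsto_rpow_atTop hε))))
    exact (isLittleO_log_rpow_atTop hε).const_mul_left (Real.log 2)⁻¹ |>.congr_left
      fun x => (div_eq_inv_mul _ _).symm
  have hpos : ∀ᶠ x : ℝ in atTop, 0 < (Real.logb 2 x + c) / x ^ ε := by
    filter_upwards [(tendsto_atTop_add_const_right _ c
      (Real.tendsto_logb_atTop one_lt_two)).eventually_gt_atTop 0, eventually_gt_atTop 0]
      with x hlog hx
    positivity
  refine (tendsto_nhdsWithin_iff.2
    ⟨hlittle.tendsto_div_nhds_zero, hpos⟩).inv_tendsto_nhdsGT_zero.congr fun x => ?_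
  rw [Pi.inv_apply, inv_div]

lemma rpow_le_self {X δ : ℝ} (hX : 1 ≤ X) (hδ : δ ≤ 1) : X ^ δ ≤ X := by
  simpa using Real.rpow_le_rpow_of_exponent_le hX hδ

theorem tendsto_f_add_rpow_sub_f {δ : ℝ} (hδ : δ ∈ Set.Ioo (1 / 2 : ℝ) 1) :
    Tendsto (fun X : ℝ => f (X + X ^ δ) - f X) atTop atTop := by
  refine tendsto_atTop_mono' _ ?_ (tendsto_atTop_add_const_right _ (-1)
    ((tendsto_rpow_div_logb_add_atTop (sub_pos.2 hδ.1) 2).atTop_div_const three_pos))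
  filter_upwards [eventually_ge_atTop 1] with X hX
  have hX0 : 0 < X := by linarith
  have hXδ := rpow_le_self hX hδ.2.le
  have hlog : Real.logb 2 (X + X ^ δ) + 1 ≤ Real.logb 2 X + 2 := by
    have h2X : Real.logb 2 (X + X ^ δ) ≤ Real.logb 2 (2 * X) :=
      Real.logb_le_logb_of_le one_lt_two (by positivity) (by linarith)
    rw [Real.logb_mul two_ne_zero hX0.ne', Real.logb_self_eq_one one_lt_two] at h2X
    linarith
  have hsqrt : X ^ (δ - 1 / 2) / 3 ≤ √(X + X ^ δ) - √X := by
    refine le_trans (le_of_eq ?_) (div_three_mul_sqrt_le_sqrt_add_sub_sqrt (by positivity) hXδ)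
    rw [Real.rpow_sub hX0, ← Real.sqrt_eq_rpow]
    ring
  have hlogY : 0 ≤ Real.logb 2 (X + X ^ δ) :=
    Real.logb_nonneg one_lt_two (by linarith [Real.rpow_nonneg hX0.le δ])
  calc X ^ (δ - 1 / 2) / (Real.logb 2 X + 2) / 3 + -1
      ≤ (√(X + X ^ δ) - √X) / (Real.logb 2 (X + X ^ δ) + 1) -
          1 / (Real.logb 2 (X + X ^ δ) + 1) := by
        rw [div_right_comm, ← sub_eq_add_neg]
        gcongr
        · exact (by positivity : 0 ≤ X ^ (δ - 1 / 2) / 3).trans hsqrt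
        · exact (div_le_one (by positivity)).2 (by linarith)
    _ ≤ f (X + X ^ δ) - f X := by
        rw [← sub_div]
        exact sqrt_sub_sqrt_div_logb_le hX (by linarith [Real.rpow_nonneg hX0.le δ])

end Normalization

section FejerKernel

/-- The Fejér kernel, written as the cosine transform of a triangle on `[0, l]`. -/
noncomputable def fejer (l u : ℝ) : ℝ := ∫ t in (0 : ℝ)..l, (1 - t / l) * Real.cos (t * u)

variable {l : ℝ}

lemma fejer_eq (hl : l ≠ 0) {u : ℝ} (hu : u ≠ 0) :
    fejer l u = (1 - Real.cos (l * u)) / (l * u ^ 2) := by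
  have hderiv (t : ℝ) : HasDerivAt
      (fun t => (1 - t / l) * (Real.sin (t * u) / u) - Real.cos (t * u) / (l * u ^ 2))
      ((1 - t / l) * Real.cos (t * u)) t := by
    have hmul : HasDerivAt (fun t : ℝ => t * u) u t := by simpa using (hasDerivAt_id t).mul_const u
    have htri : HasDerivAt (fun t : ℝ => 1 - t / l) (-(1 / l)) t := by
      simpa using ((hasDerivAt_id t).div_const l).const_sub 1
    convert! (htri.mul (hmul.sin.div_const u)).sub (hmul.cos.div_const (l * u ^ 2)) using 1
    field_simp
    ring
  rw [fejer, intervalIntegral.integral_eq_sub_of_hasDerivAt (fun t _ => hderiv t)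
    (Continuous.intervalIntegrable (by fun_prop) _ _), div_self hl]
  simp only [zero_div, zero_mul, Real.sin_zero, Real.cos_zero]
  ring

lemma integral_one_sub_div (l : ℝ) : ∫ t in (0 : ℝ)..l, (1 - t / l) = l / 2 := by
  rw [intervalIntegral.integral_sub (by simp) (Continuous.intervalIntegrable (by fun_prop) _ _),
    intervalIntegral.integral_div, integral_id, intervalIntegral.integral_const]
  rcases eq_or_ne l 0 with rfl | hl
  · simp
  · rw [smul_eq_mul]
    field_simp
    ring

lemma fejer_zero (l : ℝ) : fejer l 0 = l / 2 := by
  simpa [fejer] using integral_one_sub_div l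

lemma fejer_nonneg (hl : 0 < l) (u : ℝ) : 0 ≤ fejer l u := by
  rcases eq_or_ne u 0 with rfl | hu
  · rw [fejer_zero]
    positivity
  · rw [fejer_eq hl.ne' hu]
    exact div_nonneg (sub_nonneg.2 (Real.cos_le_one _)) (by positivity)

lemma fejer_le (hl : 0 < l) (u : ℝ) : fejer l u ≤ l / 2 := by
  rw [← integral_one_sub_div l]
  refine intervalIntegral.integral_mono_on hl.le (Continuous.intervalIntegrable (by fun_prop) _ _)
    (Continuous.intervalIntegrable (by fun_prop) _ _) fun t ht => ?_
  exact mul_le_of_le_one_right (sub_nonneg.2 ((div_le_one hl).2 ht.2)) (Real.cos_le_one _)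

lemma fejer_le_div (hl : 0 < l) {u : ℝ} (hu : u ≠ 0) : fejer l u ≤ 2 / (l * u ^ 2) := by
  rw [fejer_eq hl.ne' hu]
  gcongr
  linarith [Real.neg_one_le_cos (l * u)]

lemma div_four_le_fejer (hl : 0 < l) {u : ℝ} (hu : |u| ≤ 1 / l) : l / 4 ≤ fejer l u := by
  have hhalf : ∫ t in (0 : ℝ)..l, (1 - t / l) * (1 / 2) = l / 4 := by
    rw [intervalIntegral.integral_mul_const, integral_one_sub_div]
    ring
  rw [← hhalf]
  refine intervalIntegral.integral_mono_on hl.le (Continuous.intervalIntegrable (by fun_prop) _ _)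
    (Continuous.intervalIntegrable (by fun_prop) _ _) fun t ht => ?_
  have htu : |t * u| ≤ 1 := by
    rw [abs_mul, abs_of_nonneg ht.1]
    calc t * |u| ≤ l * (1 / l) := by gcongr; exact ht.2
      _ = 1 := by field_simp
  have hcos : 1 / 2 ≤ Real.cos (t * u) := by
    linarith [Real.one_sub_sq_div_two_le_cos (x := t * u), (sq_le_one_iff_abs_le_one _).2 htu]
  have htri : 0 ≤ 1 - t / l := sub_nonneg.2 ((div_le_one hl).2 ht.2)
  gcongr

lemma fejer_le_mul_inv_one_add_sq (hl : 0 < l) (u : ℝ) :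
    fejer l u ≤ (l / 2 + 2 / l) * (1 + u ^ 2)⁻¹ := by
  rw [← div_eq_mul_inv, le_div_iff₀ (by positivity), mul_add, mul_one]
  refine add_le_add (fejer_le hl u) ?_
  rcases eq_or_ne u 0 with rfl | hu
  · rw [zero_pow two_ne_zero, mul_zero]
    positivity
  · calc fejer l u * u ^ 2 ≤ 2 / (l * u ^ 2) * u ^ 2 := by gcongr; exact fejer_le_div hl hu
      _ = 2 / l := by field_simp

lemma fejer_le_of_le_abs (hl : 0 < l) {η u : ℝ} (hη : 0 < η) (hu : η ≤ |u|) :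
    fejer l u ≤ 2 / l * (1 + 1 / η ^ 2) * (1 + u ^ 2)⁻¹ := by
  have hu0 : u ≠ 0 := abs_pos.1 (hη.trans_le hu)
  have hsq : η ^ 2 ≤ u ^ 2 := by
    rw [← sq_abs u]
    gcongr
  calc fejer l u ≤ 2 / (l * u ^ 2) := fejer_le_div hl hu0
    _ = 2 / l * (1 + 1 / u ^ 2) * (1 + u ^ 2)⁻¹ := by field_simp; ring
    _ ≤ 2 / l * (1 + 1 / η ^ 2) * (1 + u ^ 2)⁻¹ := by gcongr

end FejerKernel

section ChebyshevBound

/-- A sequence satisfies a Chebyshev bound if the partial sums of its absolute values grow at most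
linearly, as they do for the von Mangoldt function. -/
def HasChebyshevBound (b : ℕ → ℝ) (C : ℝ) : Prop :=
  ∀ m : ℕ, ∑ n ∈ Finset.Ioc 0 m, |b n| ≤ C * m

/-- The constant, relative to the Chebyshev constant, that bounds the sums
`∑ |b n| / n * (1 + log² (n / x))⁻¹` uniformly in `x`. -/
noncomputable def windowConst : ℝ := 3 * Real.exp 1 * ∑' k : ℤ, (1 + (k : ℝ) ^ 2)⁻¹

lemma summable_inv_one_add_intCast_sq : Summable fun k : ℤ => (1 + (k : ℝ) ^ 2)⁻¹ := by
  refine Summable.of_norm_bounded_eventually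
    (Real.summable_one_div_int_pow.2 (one_lt_two : 1 < 2)) ?_
  filter_upwards [(Set.finite_singleton (0 : ℤ)).eventually_cofinite_notMem] with k hk
  have hk0 : (k : ℝ) ≠ 0 := Int.cast_ne_zero.2 hk
  rw [Real.norm_of_nonneg (by positivity), one_div]
  gcongr
  linarith

lemma inv_one_add_sq_le_floor (u : ℝ) : (1 + u ^ 2)⁻¹ ≤ 3 * (1 + (⌊u⌋ : ℝ) ^ 2)⁻¹ := by
  rw [← div_eq_mul_inv, inv_eq_one_div, div_le_div_iff₀ (by positivity) (by positivity)]
  have hle := Int.floor_le u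
  have hlt := Int.lt_floor_add_one u
  nlinarith [sq_nonneg (u + (u - ⌊u⌋)),
    mul_nonneg (sub_nonneg.2 hle) (show (0 : ℝ) ≤ 1 - (u - ⌊u⌋) by linarith)]

variable {b b' : ℕ → ℝ} {C C' x : ℝ}

lemma HasChebyshevBound.nonneg (hb : HasChebyshevBound b C) : 0 ≤ C := by
  simpa using (abs_nonneg (b 1)).trans (by simpa using hb 1)

lemma HasChebyshevBound.mono (hb : HasChebyshevBound b C) (h : ∀ n, |b' n| ≤ |b n|) :
    HasChebyshevBound b' C := fun m =>
  (Finset.sum_le_sum fun n _ => h n).trans (hb m)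

lemma HasChebyshevBound.sub (hb : HasChebyshevBound b C) (hb' : HasChebyshevBound b' C') :
    HasChebyshevBound (fun n => b n - b' n) (C + C') := fun m => by
  rw [add_mul]
  refine le_trans ?_ (add_le_add (hb m) (hb' m))
  rw [← Finset.sum_add_distrib]
  exact Finset.sum_le_sum fun n _ => abs_sub _ _

lemma hasChebyshevBound_one : HasChebyshevBound 1 1 := fun m => by simp

lemma floor_log_div_eq_iff {n : ℕ} (hn : n ≠ 0) (hx : 0 < x) {j : ℤ} :
    ⌊Real.log (n / x)⌋ = j ↔ x * Real.exp j ≤ n ∧ n < x * Real.exp (j + 1) := by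
  rw [Int.floor_eq_iff, Real.le_log_iff_exp_le (by positivity),
    Real.log_lt_iff_lt_exp (by positivity), le_div_iff₀' hx, div_lt_iff₀' hx]

lemma HasChebyshevBound.sum_floor_log_eq_le (hb : HasChebyshevBound b C) (hx : 0 < x)
    (s : Finset ℕ) (j : ℤ) :
    ∑ n ∈ s.filter fun n : ℕ => ⌊Real.log (n / x)⌋ = j, |b n| / n ≤ C * Real.exp 1 := by
  have hC := hb.nonneg
  have hmem : ∀ n ∈ (s.filter fun n : ℕ => ⌊Real.log (n / x)⌋ = j).erase 0,
      n ≠ 0 ∧ x * Real.exp j ≤ n ∧ n < x * Real.exp (j + 1) := fun n hn => by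
    obtain ⟨hn0, hn⟩ := Finset.mem_erase.1 hn
    exact ⟨hn0, (floor_log_div_eq_iff hn0 hx).1 (Finset.mem_filter.1 hn).2⟩
  rw [← Finset.sum_erase _ (a := 0) (by simp)]
  calc ∑ n ∈ (s.filter fun n : ℕ => ⌊Real.log (n / x)⌋ = j).erase 0, |b n| / n
      ≤ ∑ n ∈ (s.filter fun n : ℕ => ⌊Real.log (n / x)⌋ = j).erase 0, |b n| / (x * Real.exp j) :=
        Finset.sum_le_sum fun n hn => by
          gcongr
          exact (hmem n hn).2.1
    _ ≤ (∑ n ∈ Finset.Ioc 0 ⌊x * Real.exp (j + 1)⌋₊, |b n|) / (x * Real.exp j) := by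
        rw [← Finset.sum_div]
        gcongr
        intro n hn
        obtain ⟨hn0, -, hlt⟩ := hmem n hn
        exact Finset.mem_Ioc.2 ⟨Nat.pos_of_ne_zero hn0, Nat.le_floor hlt.le⟩
    _ ≤ C * (x * Real.exp (j + 1)) / (x * Real.exp j) := by
        gcongr
        exact (hb _).trans (by gcongr; exact Nat.floor_le (by positivity))
    _ = C * Real.exp 1 := by
        rw [Real.exp_add]
        field_simp

lemma HasChebyshevBound.sum_le (hb : HasChebyshevBound b C) (hx : 0 < x) (s : Finset ℕ) :
    ∑ n ∈ s, |b n| / n * (1 + Real.log (n / x) ^ 2)⁻¹ ≤ C * windowConst := by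
  have hC := hb.nonneg
  rw [← Finset.sum_fiberwise_of_maps_to (t := s.image fun n : ℕ => ⌊Real.log (n / x)⌋)
    fun n hn => Finset.mem_image_of_mem (fun n : ℕ => ⌊Real.log (n / x)⌋) hn]
  calc ∑ j ∈ s.image fun n : ℕ => ⌊Real.log (n / x)⌋,
          ∑ n ∈ s.filter fun n : ℕ => ⌊Real.log (n / x)⌋ = j,
            |b n| / n * (1 + Real.log (n / x) ^ 2)⁻¹
      ≤ ∑ j ∈ s.image fun n : ℕ => ⌊Real.log (n / x)⌋,
          C * Real.exp 1 * (3 * (1 + (j : ℝ) ^ 2)⁻¹) := by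
        refine Finset.sum_le_sum fun j _ => ?_
        refine le_trans ?_ (mul_le_mul_of_nonneg_right (hb.sum_floor_log_eq_le hx s j)
          (by positivity))
        rw [Finset.sum_mul]
        refine Finset.sum_le_sum fun n hn => ?_
        gcongr
        exact (Finset.mem_filter.1 hn).2 ▸ inv_one_add_sq_le_floor _
    _ = C * (3 * Real.exp 1 * ∑ j ∈ s.image fun n : ℕ => ⌊Real.log (n / x)⌋,
          (1 + (j : ℝ) ^ 2)⁻¹) := by
        rw [← Finset.mul_sum, ← Finset.mul_sum]
        ring
    _ ≤ C * windowConst := by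
        unfold windowConst
        gcongr
        exact summable_inv_one_add_intCast_sq.sum_le_tsum _ fun j _ => by positivity

lemma HasChebyshevBound.summable (hb : HasChebyshevBound b C) (hx : 0 < x) :
    Summable fun n : ℕ => |b n| / n * (1 + Real.log (n / x) ^ 2)⁻¹ :=
  summable_of_sum_le (fun n => by positivity) (hb.sum_le hx)

lemma HasChebyshevBound.tsum_le (hb : HasChebyshevBound b C) (hx : 0 < x) :
    ∑' n : ℕ, |b n| / n * (1 + Real.log (n / x) ^ 2)⁻¹ ≤ C * windowConst :=
  (hb.summable hx).tsum_le_of_sum_le (hb.sum_le hx)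

end ChebyshevBound

section TauberianTheorem

open MeasureTheory

/-- The Fejér mean of `b n / n` over the multiplicative neighbourhoods of `x`. -/
noncomputable def fejerMean (b : ℕ → ℝ) (l x : ℝ) : ℝ :=
  ∑' n : ℕ, b n / n * fejer l (Real.log (n / x))

/-- The Fourier transform, at frequency `log x`, of `G` on the line `re s = σ` weighted by a
triangle. For the sum `G` of a Dirichlet series, its real part is a Fejér mean. -/
noncomputable def fejerTransform (G : ℂ → ℂ) (l σ x : ℝ) : ℂ :=
  ∫ t in (0 : ℝ)..l, ((1 - t / l : ℝ) : ℂ) *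
    (G (σ + t * Complex.I) * Complex.exp ((t * Real.log x : ℝ) * Complex.I))

variable {b : ℕ → ℝ} {C l x σ : ℝ} {G : ℂ → ℂ}

lemma HasChebyshevBound.summable_mul_fejer (hb : HasChebyshevBound b C) (hl : 0 < l) (hx : 0 < x) :
    Summable fun n : ℕ => b n / n * fejer l (Real.log (n / x)) := by
  refine Summable.of_norm_bounded ((hb.summable hx).mul_left (l / 2 + 2 / l)) fun n => ?_
  rw [norm_mul, norm_div, Real.norm_eq_abs, Real.norm_natCast,
    Real.norm_of_nonneg (fejer_nonneg hl _), mul_left_comm]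
  gcongr
  exact fejer_le_mul_inv_one_add_sq hl _

lemma tendsto_fejer_log_div (hl : 0 < l) {n : ℕ} (hn : n ≠ 0) :
    Tendsto (fun x : ℝ => fejer l (Real.log (n / x))) atTop (𝓝 0) := by
  have hlog : Tendsto (fun x : ℝ => Real.log (n / x)) atTop atBot := by
    refine Real.tendsto_log_nhdsGT_zero.comp (tendsto_nhdsWithin_iff.2
      ⟨tendsto_const_nhds.div_atTop tendsto_id, ?_⟩)
    filter_upwards [eventually_gt_atTop 0] with x hx
    exact div_pos (by positivity) hx
  have hsq : Tendsto (fun x : ℝ => 1 + Real.log (n / x) ^ 2) atTop atTop := by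
    simp only [sq]
    exact tendsto_atTop_add_const_left _ _ (hlog.atBot_mul_atBot₀ hlog)
  refine squeeze_zero (fun x => fejer_nonneg hl _) (fun x => fejer_le_mul_inv_one_add_sq hl _) ?_
  simpa using hsq.inv_tendsto_atTop.const_mul (l / 2 + 2 / l)

lemma tendsto_fejerMean_of_summable (hl : 0 < l) (hb : Summable fun n : ℕ => |b n| / n) :
    Tendsto (fejerMean b l) atTop (𝓝 0) := by
  rw [← tsum_zero (β := ℕ)]
  refine tendsto_tsum_of_dominated_convergence (hb.mul_right (l / 2)) (fun n => ?_)
    (Eventually.of_forall fun x n => ?_)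
  · rcases eq_or_ne n 0 with rfl | hn
    · simp
    · simpa using (tendsto_fejer_log_div hl hn).const_mul (b n / n)
  · rw [norm_mul, norm_div, Real.norm_eq_abs, Real.norm_natCast,
      Real.norm_of_nonneg (fejer_nonneg hl _)]
    gcongr
    exact fejer_le hl _

lemma norm_triangle_mul_le {t : ℝ} (hl : 0 < l) (ht : t ∈ Set.uIoc 0 l) (z : ℂ) (r : ℝ) :
    ‖((1 - t / l : ℝ) : ℂ) * (z * Complex.exp (r * Complex.I))‖ ≤ ‖z‖ := by
  rw [Set.uIoc_of_le hl.le] at ht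
  rw [norm_mul, norm_mul, Complex.norm_exp_ofReal_mul_I, mul_one, Complex.norm_real,
    Real.norm_of_nonneg (sub_nonneg.2 ((div_le_one hl).2 ht.2))]
  exact mul_le_of_le_one_left (norm_nonneg _) (sub_le_self _ (div_nonneg ht.1.le hl.le))

lemma term_add_mul_I_mul_exp (a : ℕ → ℂ) (n : ℕ) (σ t : ℝ) (hx : 0 < x) :
    LSeries.term a (σ + t * Complex.I) n * Complex.exp ((t * Real.log x : ℝ) * Complex.I)
      = LSeries.term a σ n * Complex.exp ((-(t * Real.log (n / x)) : ℝ) * Complex.I) := by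
  rcases eq_or_ne n 0 with rfl | hn
  · simp
  have hn0 : (n : ℂ) ≠ 0 := Nat.cast_ne_zero.2 hn
  rw [LSeries.term_of_ne_zero hn, LSeries.term_of_ne_zero hn, Complex.cpow_add _ _ hn0,
    Complex.cpow_def_of_ne_zero hn0 (t * Complex.I), ← Complex.natCast_log, ← div_div,
    div_mul_eq_mul_div, mul_div_assoc, ← Complex.exp_sub,
    Real.log_div (Nat.cast_ne_zero.2 hn) hx.ne']
  congr 2
  push_cast
  ring

lemma term_ofReal_eq (b : ℕ → ℝ) (hσ : σ ≠ 0) (n : ℕ) :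
    LSeries.term (fun n => (b n : ℂ)) σ n = ((b n * (n : ℝ) ^ (-σ) : ℝ) : ℂ) := by
  rcases eq_or_ne n 0 with rfl | hn
  · simp [Real.zero_rpow (neg_ne_zero.2 hσ)]
  · rw [LSeries.term_of_ne_zero hn, Real.rpow_neg n.cast_nonneg, Complex.ofReal_mul,
      Complex.ofReal_inv, Complex.ofReal_cpow n.cast_nonneg, div_eq_mul_inv]
    rfl

lemma re_integral_triangle_mul_exp (l u : ℝ) :
    (∫ t in (0 : ℝ)..l, ((1 - t / l : ℝ) : ℂ) *
      Complex.exp ((-(t * u) : ℝ) * Complex.I)).re = fejer l u := by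
  rw [fejer, ← Complex.reCLM_apply, ← Complex.reCLM.intervalIntegral_comp_comm
    (Continuous.intervalIntegrable (by fun_prop) _ _)]
  refine intervalIntegral.integral_congr fun t _ => ?_
  simp only [Complex.reCLM_apply, Complex.re_ofReal_mul]
  rw [Complex.exp_ofReal_mul_I_re, Real.cos_neg]

lemma hasSum_mul_rpow_mul_fejer (hl : 0 < l) (hx : 0 < x) (hσ : σ ≠ 0)
    (hG : ∀ t : ℝ, LSeriesHasSum (fun n => (b n : ℂ)) (σ + t * Complex.I)
      (G (σ + t * Complex.I))) :
    HasSum (fun n : ℕ => b n * (n : ℝ) ^ (-σ) * fejer l (Real.log (n / x)))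
      (fejerTransform G l σ x).re := by
  set a : ℕ → ℂ := fun n => (b n : ℂ)
  have hsum : HasSum (fun n : ℕ => ∫ t in (0 : ℝ)..l, ((1 - t / l : ℝ) : ℂ) *
      (LSeries.term a (σ + t * Complex.I) n * Complex.exp ((t * Real.log x : ℝ) * Complex.I)))
      (fejerTransform G l σ x) := by
    refine intervalIntegral.hasSum_integral_of_dominated_convergence
      (fun n _ => ‖LSeries.term a σ n‖) (fun n => ?_)
      (fun n => Eventually.of_forall fun t ht => ?_) (Eventually.of_forall fun t _ => ?_)
      intervalIntegrable_const
      (Eventually.of_forall fun t _ => ((hG t).mul_right _).mul_left _)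
    · simp_rw [term_add_mul_I_mul_exp a n σ _ hx]
      exact Continuous.aestronglyMeasurable (by fun_prop)
    · rw [term_add_mul_I_mul_exp a n σ t hx]
      exact norm_triangle_mul_le hl ht _ _
    · simpa using (hG 0).LSeriesSummable.norm
  convert! Complex.hasSum_re hsum using 1
  ext n
  simp_rw [term_add_mul_I_mul_exp a n σ _ hx, a, term_ofReal_eq b hσ,
    mul_left_comm ((1 - _ / l : ℝ) : ℂ)]
  rw [intervalIntegral.integral_const_mul, Complex.re_ofReal_mul, re_integral_triangle_mul_exp]

lemma continuous_vertical_line (hG : ContinuousOn G {s : ℂ | 1 ≤ s.re}) (hσ : 1 ≤ σ) :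
    Continuous fun t : ℝ => G (σ + t * Complex.I) :=
  hG.comp_continuous (by fun_prop) fun t => by simpa using hσ

lemma tendsto_fejerTransform_nhdsGT_one (hl : 0 < l) (hG : ContinuousOn G {s : ℂ | 1 ≤ s.re})
    (x : ℝ) :
    Tendsto (fun σ => fejerTransform G l σ x) (𝓝[>] 1) (𝓝 (fejerTransform G l 1 x)) := by
  obtain ⟨B, hB⟩ := ((isCompact_Icc (a := (1 : ℝ)) (b := 2)).prod
    (isCompact_Icc (a := 0) (b := l))).exists_bound_of_continuousOn
    (f := fun p : ℝ × ℝ => G (p.1 + p.2 * Complex.I))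
    (hG.comp (by fun_prop) fun p hp => by simpa using hp.1.1)
  refine intervalIntegral.tendsto_integral_filter_of_dominated_convergence (fun _ => B) ?_ ?_
    intervalIntegrable_const (Eventually.of_forall fun t _ => ?_)
  · filter_upwards [self_mem_nhdsWithin] with σ hσ
    exact ((by fun_prop : Continuous fun t : ℝ => ((1 - t / l : ℝ) : ℂ)).mul
      ((continuous_vertical_line hG (le_of_lt hσ)).mul (by fun_prop))).aestronglyMeasurable
  · filter_upwards [Ioo_mem_nhdsGT (one_lt_two (α := ℝ))] with σ hσ
    refine Eventually.of_forall fun t ht => (norm_triangle_mul_le hl ht _ _).trans ?_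
    rw [Set.uIoc_of_le hl.le] at ht
    exact hB (σ, t) ⟨⟨hσ.1.le, hσ.2.le⟩, ht.1.le, ht.2⟩
  · refine Tendsto.const_mul _ (Tendsto.mul_const _ ?_)
    refine (hG ((1 : ℝ) + t * Complex.I) (by simp)).tendsto.comp
      (tendsto_nhdsWithin_iff.2 ⟨?_, ?_⟩)
    · exact (Continuous.tendsto (f := fun σ : ℝ => (σ : ℂ) + t * Complex.I) (by fun_prop)
        1).mono_left nhdsWithin_le_nhds
    · filter_upwards [self_mem_nhdsWithin] with σ hσ
      simpa using le_of_lt hσ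

lemma tendsto_fejerTransform_atTop (hl : 0 ≤ l) (G : ℂ → ℂ) (σ : ℝ) :
    Tendsto (fejerTransform G l σ) atTop (𝓝 0) := by
  set g : ℝ → ℂ := (Set.Ioc 0 l).indicator
    fun t => ((1 - t / l : ℝ) : ℂ) * G (σ + t * Complex.I)
  have hfreq : Tendsto (fun x : ℝ => -(Real.log x / (2 * Real.pi))) atTop (cocompact ℝ) := by
    rw [cocompact_eq_atBot_atTop]
    exact (tendsto_neg_atTop_atBot.comp
      (Real.tendsto_log_atTop.atTop_div_const (by positivity))).mono_right le_sup_left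
  refine ((Real.tendsto_integral_exp_smul_cocompact g).comp hfreq).congr fun x => ?_
  rw [Function.comp_apply, fejerTransform, intervalIntegral.integral_of_le hl,
    ← integral_indicator measurableSet_Ioc]
  refine integral_congr_ae (Eventually.of_forall fun t => ?_)
  by_cases ht : t ∈ Set.Ioc 0 l
  · simp only [g, Set.indicator_of_mem ht]
    rw [Circle.smul_def, Real.fourierChar_apply, smul_eq_mul, mul_comm, mul_assoc]
    congr 3
    have := Real.pi_ne_zero
    push_cast
    field_simp
  · simp only [g, Set.indicator_of_notMem ht, smul_zero]

lemma tendsto_natCast_rpow_neg_nhdsGT_one (n : ℕ) :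
    Tendsto (fun σ : ℝ => (n : ℝ) ^ (-σ)) (𝓝[>] 1) (𝓝 (n : ℝ)⁻¹) := by
  rw [← Real.rpow_neg_one]
  exact ((Real.continuousAt_const_rpow' (by simp)).comp continuousAt_neg).tendsto.mono_left
    nhdsWithin_le_nhds

lemma natCast_rpow_neg_le_inv (hσ : 1 ≤ σ) (n : ℕ) : (n : ℝ) ^ (-σ) ≤ (n : ℝ)⁻¹ := by
  rcases eq_or_ne n 0 with rfl | hn
  · simp [Real.zero_rpow (neg_ne_zero.2 (by linarith : σ ≠ 0))]
  · rw [← Real.rpow_neg_one]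
    exact Real.rpow_le_rpow_of_exponent_le (by exact_mod_cast Nat.pos_of_ne_zero hn) (by linarith)

lemma fejerMean_eq_re_fejerTransform (hl : 0 < l) (hx : 0 < x) (hb : HasChebyshevBound b C)
    (hG : ContinuousOn G {s : ℂ | 1 ≤ s.re})
    (hbG : ∀ s : ℂ, 1 < s.re → LSeriesHasSum (fun n => (b n : ℂ)) s (G s)) :
    fejerMean b l x = (fejerTransform G l 1 x).re := by
  refine tendsto_nhds_unique (f := fun σ => (fejerTransform G l σ x).re) (l := 𝓝[>] 1) ?_
    ((Complex.continuous_re.tendsto _).comp (tendsto_fejerTransform_nhdsGT_one hl hG x))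
  suffices Tendsto (fun σ : ℝ => ∑' n : ℕ, b n * (n : ℝ) ^ (-σ) * fejer l (Real.log (n / x)))
      (𝓝[>] 1) (𝓝 (fejerMean b l x)) by
    refine this.congr' ?_
    filter_upwards [self_mem_nhdsWithin] with σ hσ
    exact (hasSum_mul_rpow_mul_fejer hl hx (zero_lt_one.trans hσ).ne'
      fun t => hbG _ (by simpa using hσ)).tsum_eq
  refine tendsto_tsum_of_dominated_convergence (hb.summable_mul_fejer hl hx).norm (fun n => ?_) ?_
  · rw [div_eq_mul_inv]
    exact ((tendsto_natCast_rpow_neg_nhdsGT_one n).const_mul _).mul_const _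
  · filter_upwards [self_mem_nhdsWithin] with σ hσ n
    rw [norm_mul, norm_mul, norm_mul, norm_div, div_eq_mul_inv ‖b n‖,
      Real.norm_of_nonneg (Real.rpow_nonneg n.cast_nonneg _), Real.norm_natCast]
    gcongr ‖b n‖ * ?_ * _
    exact natCast_rpow_neg_le_inv (le_of_lt hσ) n

theorem tendsto_fejerMean_of_LSeriesHasSum (hl : 0 < l) (hb : HasChebyshevBound b C)
    (hG : ContinuousOn G {s : ℂ | 1 ≤ s.re})
    (hbG : ∀ s : ℂ, 1 < s.re → LSeriesHasSum (fun n => (b n : ℂ)) s (G s)) :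
    Tendsto (fejerMean b l) atTop (𝓝 0) := by
  rw [← Complex.zero_re]
  refine ((Complex.continuous_re.tendsto 0).comp (tendsto_fejerTransform_atTop hl.le G 1)).congr' ?_
  filter_upwards [eventually_gt_atTop 0] with x hx
  exact (fejerMean_eq_re_fejerTransform hl hx hb hG hbG).symm

end TauberianTheorem

section MultiplicativeNeighbourhoods

variable {b b' : ℕ → ℝ} {C C' l η x : ℝ}

lemma fejerMean_sub (hb : HasChebyshevBound b C) (hb' : HasChebyshevBound b' C') (hl : 0 < l)
    (hx : 0 < x) :
    fejerMean (fun n => b n - b' n) l x = fejerMean b l x - fejerMean b' l x := by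
  simp only [fejerMean, sub_div, sub_mul]
  exact (hb.summable_mul_fejer hl hx).tsum_sub (hb'.summable_mul_fejer hl hx)

lemma HasChebyshevBound.fejerMean_le_of_forall_le_abs_log (hb : HasChebyshevBound b C) (hl : 0 < l)
    (hη : 0 < η) (hx : 0 < x) (hgap : ∀ n : ℕ, b n ≠ 0 → η ≤ |Real.log (n / x)|) :
    fejerMean b l x ≤ 2 / l * (1 + 1 / η ^ 2) * (C * windowConst) := by
  calc fejerMean b l x
      ≤ ∑' n : ℕ, 2 / l * (1 + 1 / η ^ 2) * (|b n| / n * (1 + Real.log (n / x) ^ 2)⁻¹) := by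
        refine (hb.summable_mul_fejer hl hx).tsum_le_tsum (fun n => ?_)
          ((hb.summable hx).mul_left _)
        rcases eq_or_ne (b n) 0 with hbn | hbn
        · simp [hbn]
        · rw [mul_left_comm]
          refine mul_le_mul (by gcongr; exact le_abs_self _)
            (fejer_le_of_le_abs hl hη (hgap n hbn)) (fejer_nonneg hl _) (by positivity)
    _ ≤ 2 / l * (1 + 1 / η ^ 2) * (C * windowConst) := by
        rw [tsum_mul_left]
        gcongr
        exact hb.tsum_le hx

lemma sub_one_le_card_Icc_ceil_floor {X Y : ℝ} (hX : 0 ≤ X) :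
    Y - X - 1 ≤ ((Finset.Icc ⌈X⌉₊ ⌊Y⌋₊).card : ℝ) := by
  have hY := Nat.lt_floor_add_one Y
  have hceil := Nat.ceil_lt_add_one hX
  have hsub : ((⌊Y⌋₊ + 1 : ℕ) : ℝ) ≤ ((⌊Y⌋₊ + 1 - ⌈X⌉₊ : ℕ) : ℝ) + (⌈X⌉₊ : ℝ) := by
    exact_mod_cast le_tsub_add
  rw [Nat.card_Icc]
  push_cast at hsub
  linarith

lemma one_div_sixteen_le_fejerMean_one (hl : 1 ≤ l) (hx : 2 * l ≤ x) :
    1 / 16 ≤ fejerMean 1 l x := by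
  have hl0 : 0 < l := by linarith
  have hx0 : 0 < x := by linarith
  have hterm : ∀ n ∈ Finset.Icc ⌈x⌉₊ ⌊x + x / l⌋₊,
      1 / (2 * x) * (l / 4) ≤ (1 : ℕ → ℝ) n / n * fejer l (Real.log (n / x)) := fun n hn => by
    obtain ⟨hxn, hnx⟩ := Finset.mem_Icc.1 hn
    rw [Nat.ceil_le] at hxn
    rw [Nat.le_floor_iff (by positivity)] at hnx
    have hn0 : (0 : ℝ) < n := hx0.trans_le hxn
    have hdiv : x / l ≤ x := div_le_self hx0.le hl
    have hlog : |Real.log (n / x)| ≤ 1 / l := by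
      rw [abs_of_nonneg (Real.log_nonneg ((one_le_div hx0).2 hxn))]
      refine (Real.log_le_sub_one_of_pos (by positivity)).trans ?_
      rw [sub_le_iff_le_add, div_le_iff₀ hx0]
      linarith [one_div_mul_eq_div l x]
    exact mul_le_mul (one_div_le_one_div_of_le hn0 (by linarith)) (div_four_le_fejer hl0 hlog)
      (by positivity) (one_div_nonneg.2 hn0.le)
  calc (1 : ℝ) / 16 ≤ (x + x / l - x - 1) * (1 / (2 * x) * (l / 4)) := by
        field_simp
        linarith
    _ ≤ (Finset.Icc ⌈x⌉₊ ⌊x + x / l⌋₊).card • (1 / (2 * x) * (l / 4)) := by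
        rw [nsmul_eq_mul]
        gcongr
        exact sub_one_le_card_Icc_ceil_floor hx0.le
    _ ≤ ∑ n ∈ Finset.Icc ⌈x⌉₊ ⌊x + x / l⌋₊, (1 : ℕ → ℝ) n / n * fejer l (Real.log (n / x)) :=
        Finset.card_nsmul_le_sum _ _ _ hterm
    _ ≤ fejerMean 1 l x :=
        (hasChebyshevBound_one.summable_mul_fejer hl0 hx0).sum_le_tsum _ fun n _ =>
          mul_nonneg (div_nonneg zero_le_one n.cast_nonneg) (fejer_nonneg hl0 _)

-- If `b` vanished near `x`, its Fejér mean would be `O(1 / l)`, contradicting the comparison with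
-- the mean of `1`, which is bounded below uniformly in `l`.
theorem HasChebyshevBound.eventually_exists_abs_log_lt (hb : HasChebyshevBound b C)
    (hmean : ∀ l : ℝ, 0 < l → Tendsto (fun x => fejerMean b l x - fejerMean 1 l x) atTop (𝓝 0))
    (hη : 0 < η) :
    ∀ᶠ x : ℝ in atTop, ∃ n : ℕ, b n ≠ 0 ∧ |Real.log (n / x)| < η := by
  have hlarge : Tendsto (fun l : ℝ => 2 / l * (1 + 1 / η ^ 2) * (C * windowConst)) atTop (𝓝 0) := by
    have hdiv : Tendsto (fun l : ℝ => 2 / l) atTop (𝓝 0) :=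
      tendsto_const_nhds.div_atTop tendsto_id
    simpa only [zero_mul] using (hdiv.mul_const (1 + 1 / η ^ 2)).mul_const (C * windowConst)
  obtain ⟨l, hl, hsmall⟩ := ((eventually_ge_atTop 1).and
    (hlarge.eventually (gt_mem_nhds (by norm_num : (0 : ℝ) < 1 / 32)))).exists
  have hl0 : 0 < l := by linarith
  filter_upwards [(hmean l hl0).eventually (lt_mem_nhds (by norm_num : -(1 / 32 : ℝ) < 0)),
    eventually_ge_atTop (2 * l)] with x hclose hx
  by_contra! hgap
  linarith [hb.fejerMean_le_of_forall_le_abs_log hl0 hη (by linarith) hgap,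
    one_div_sixteen_le_fejerMean_one hl hx]

end MultiplicativeNeighbourhoods

section Primes

open ArithmeticFunction DirichletCharacter

/-- The von Mangoldt function restricted to the primes. -/
noncomputable def primeLog (n : ℕ) : ℝ := if n.Prime then Λ n else 0

lemma continuousOn_neg_logDeriv_sub_dslope_LFunctionTrivChar₁ :
    ContinuousOn (fun s => -deriv (LFunctionTrivChar₁ 1) s / LFunctionTrivChar₁ 1 s
      - dslope (LFunctionTrivChar₁ 1) 1 s) {s : ℂ | 1 ≤ s.re} := by
  refine ((continuousOn_neg_logDeriv_LFunctionTrivChar₁ 1).mono fun s hs => ?_).sub ?_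
  · rw [LFunctionTrivChar, LFunction_modOne_eq]
    exact Or.inr (riemannZeta_ne_zero_of_one_le_re hs)
  · have hdiff := differentiable_LFunctionTrivChar₁ 1
    exact (continuousOn_dslope Filter.univ_mem).2 ⟨hdiff.continuous.continuousOn, hdiff 1⟩
      |>.mono (Set.subset_univ _)

lemma neg_logDeriv_sub_dslope_LFunctionTrivChar₁_eq {s : ℂ} (hs : 1 < s.re) :
    -deriv (LFunctionTrivChar₁ 1) s / LFunctionTrivChar₁ 1 s - dslope (LFunctionTrivChar₁ 1) 1 s
      = -deriv riemannZeta s / riemannZeta s - riemannZeta s := by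
  have hs1 : s ≠ 1 := by
    rintro rfl
    simp at hs
  have hs1' : s - 1 ≠ 0 := sub_ne_zero.2 hs1
  have hζ : riemannZeta s ≠ 0 := riemannZeta_ne_zero_of_one_le_re hs.le
  have htriv : LFunctionTrivChar 1 = riemannZeta := LFunction_modOne_eq
  have hone : LFunctionTrivChar₁ 1 1 = 1 := by simp [LFunctionTrivChar₁]
  have heq : LFunctionTrivChar₁ 1 s = (s - 1) * riemannZeta s := by
    rw [LFunctionTrivChar₁, Function.update_of_ne hs1, htriv]
  rw [dslope_of_ne _ hs1, slope_def_field, deriv_LFunctionTrivChar₁_apply_of_ne_one 1 hs1, hone,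
    heq, htriv]
  field_simp
  ring

lemma LSeriesHasSum_vonMangoldt_sub_one {s : ℂ} (hs : 1 < s.re) :
    LSeriesHasSum (fun n => ((Λ n - 1 : ℝ) : ℂ)) s
      (-deriv riemannZeta s / riemannZeta s - riemannZeta s) := by
  rw [← LSeries_vonMangoldt_eq_deriv_riemannZeta_div hs, ← LSeries_one_eq_riemannZeta hs]
  convert! (LSeriesSummable_vonMangoldt hs).LSeriesHasSum.sub
    (LSeriesSummable_one_iff.2 hs).LSeriesHasSum using 1
  ext n
  simp

lemma hasChebyshevBound_vonMangoldt : HasChebyshevBound (fun n => Λ n) (Real.log 4 + 4) :=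
  fun m => by
    simpa [abs_of_nonneg vonMangoldt_nonneg, Chebyshev.psi] using
      Chebyshev.psi_le_const_mul_self m.cast_nonneg

lemma hasChebyshevBound_primeLog : HasChebyshevBound primeLog (Real.log 4 + 4) :=
  hasChebyshevBound_vonMangoldt.mono fun n => by
    unfold primeLog
    split_ifs <;> simp

lemma summable_abs_vonMangoldt_sub_primeLog_div :
    Summable fun n : ℕ => |Λ n - primeLog n| / n := by
  refine (vonMangoldt.summable_residueClass_non_primes_div (0 : ZMod 1)).congr fun n => ?_
  have hres : vonMangoldt.residueClass (0 : ZMod 1) n = Λ n :=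
    Set.indicator_of_mem (s := {n : ℕ | (n : ZMod 1) = 0}) (Subsingleton.elim _ _) _
  rw [hres, primeLog]
  split_ifs <;> simp [abs_of_nonneg vonMangoldt_nonneg]

lemma tendsto_fejerMean_primeLog_sub_fejerMean_one {l : ℝ} (hl : 0 < l) :
    Tendsto (fun x => fejerMean primeLog l x - fejerMean 1 l x) atTop (𝓝 0) := by
  have hvonMangoldt : Tendsto (fejerMean (fun n => Λ n - 1) l) atTop (𝓝 0) :=
    tendsto_fejerMean_of_LSeriesHasSum hl (hasChebyshevBound_vonMangoldt.sub hasChebyshevBound_one)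
      continuousOn_neg_logDeriv_sub_dslope_LFunctionTrivChar₁ fun s hs =>
        neg_logDeriv_sub_dslope_LFunctionTrivChar₁_eq hs ▸ LSeriesHasSum_vonMangoldt_sub_one hs
  have hnonprime := tendsto_fejerMean_of_summable hl summable_abs_vonMangoldt_sub_primeLog_div
  rw [← sub_zero 0]
  refine (hvonMangoldt.sub hnonprime).congr' ?_
  filter_upwards [eventually_gt_atTop 0] with x hx
  rw [fejerMean_sub hasChebyshevBound_vonMangoldt hasChebyshevBound_primeLog hl hx]
  have hone := fejerMean_sub hasChebyshevBound_vonMangoldt hasChebyshevBound_one hl hx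
  simp only [Pi.one_apply] at hone
  rw [hone]
  ring

lemma eventually_exists_prime_abs_log_lt {η : ℝ} (hη : 0 < η) :
    ∀ᶠ x : ℝ in atTop, ∃ p : ℕ, p.Prime ∧ |Real.log (p / x)| < η := by
  filter_upwards [hasChebyshevBound_primeLog.eventually_exists_abs_log_lt
    (fun _ => tendsto_fejerMean_primeLog_sub_fejerMean_one) hη] with x ⟨p, hp, hpx⟩
  exact ⟨p, by_contra fun h => hp (if_neg h), hpx⟩

lemma nextPrime_spec (x : ℝ) : (nextPrime x).Prime ∧ x ≤ nextPrime x := by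
  refine Nat.sInf_mem (s := {p : ℕ | p.Prime ∧ x ≤ p}) ?_
  obtain ⟨p, hle, hp⟩ := Nat.exists_infinite_primes ⌈x⌉₊
  exact ⟨p, hp, (Nat.le_ceil x).trans (by exact_mod_cast hle)⟩

lemma nextPrime_le {p : ℕ} {x : ℝ} (hp : p.Prime) (hx : x ≤ p) : nextPrime x ≤ p :=
  Nat.sInf_le ⟨hp, hx⟩

lemma eventually_nextPrime_le_mul {a : ℝ} (ha : 1 < a) :
    ∀ᶠ x : ℝ in atTop, (nextPrime x : ℝ) ≤ a * x := by
  set η := Real.log a / 2 with hη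
  have hη0 : 0 < η := half_pos (Real.log_pos ha)
  filter_upwards [(tendsto_id.atTop_mul_const (Real.exp_pos η)).eventually
    (eventually_exists_prime_abs_log_lt hη0), eventually_gt_atTop 0] with x ⟨p, hp, hpx⟩ hx
  have hp0 : (0 : ℝ) < p := Nat.cast_pos.2 hp.pos
  rw [id, ← div_div, Real.log_div (by positivity) (Real.exp_ne_zero η), Real.log_exp, abs_lt] at hpx
  have hlower : x ≤ p := (one_le_div hx).1 ((Real.log_nonneg_iff (by positivity)).1 (by linarith))
  have hupper : (p : ℝ) ≤ a * x := by
    rw [← div_le_iff₀ hx, ← Real.log_le_log_iff (by positivity) (by linarith)]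
    linarith
  exact (Nat.cast_le.2 (nextPrime_le hp hlower)).trans hupper

theorem tendsto_nextPrime_div : Tendsto (fun x : ℝ => (nextPrime x : ℝ) / x) atTop (𝓝 1) := by
  refine tendsto_order.2 ⟨fun a ha => ?_, fun a ha => ?_⟩
  · filter_upwards [eventually_gt_atTop 0] with x hx
    exact ha.trans_le ((one_le_div hx).2 (nextPrime_spec x).2)
  · obtain ⟨c, hc, hca⟩ := exists_between ha
    filter_upwards [eventually_nextPrime_le_mul hc, eventually_gt_atTop 0] with x hle hx
    exact ((div_le_iff₀ hx).2 hle).trans_lt hca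

end Primes

section Averages

variable {s : ℂ} {N q : ℕ} {X Y y ε : ℝ}

open Classical in
/-- The elements of `S` in the real interval `[X, Y]`. -/
noncomputable def conductors (X Y : ℝ) : Finset ℕ :=
  (Finset.Icc ⌈X⌉₊ ⌊Y⌋₊).filter (fun N => N ∈ S)

open Classical in
lemma mem_conductors : N ∈ conductors X Y ↔ X ≤ N ∧ N ≤ Y ∧ N ∈ S := by
  rw [conductors, Finset.mem_filter, Finset.mem_Icc, Nat.ceil_le, and_assoc]
  refine and_congr_right fun _ => and_congr_left fun hN => ?_
  exact Nat.le_floor_iff' hN.1.ne'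

open Classical in
lemma card_conductors_le (hX : 0 ≤ X) (hXY : X ≤ Y) : ((conductors X Y).card : ℝ) ≤ Y - X + 1 := by
  have hfloor : X ≤ ⌊Y⌋₊ + 1 := hXY.trans (Nat.lt_floor_add_one Y).le
  calc ((conductors X Y).card : ℝ) ≤ ((⌊Y⌋₊ + 1 - ⌈X⌉₊ : ℕ) : ℝ) := by
        rw [← Nat.card_Icc]
        exact_mod_cast Finset.card_filter_le _ _
    _ ≤ Y - X + 1 := by
        rw [Nat.cast_sub (Nat.ceil_le.2 (by exact_mod_cast hfloor))]
        push_cast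
        linarith [Nat.le_ceil X, Nat.floor_le (hX.trans hXY)]

lemma totient_div_le_one (N : ℕ) : (N.totient : ℝ) / N ≤ 1 :=
  div_le_one_of_le₀ (by exact_mod_cast N.totient_le) N.cast_nonneg

open Classical in
lemma abs_sum_conductors_sub_le (hXY : X ≤ Y) :
    |∑ N ∈ conductors X Y, (N.totient : ℝ) / N - (f Y - f X)| ≤ 1 := by
  rw [f_sub_f hXY]
  set A := (Finset.Ioc ⌊X⌋₊ ⌊Y⌋₊).filter (fun N => N ∈ S)
  have hsub : A ⊆ conductors X Y := fun N hN => by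
    simp only [A, conductors, Finset.mem_filter, Finset.mem_Ioc, Finset.mem_Icc] at hN ⊢
    exact ⟨⟨(Nat.ceil_le_floor_add_one X).trans hN.1.1, hN.1.2⟩, hN.2⟩
  have hdiff : conductors X Y \ A ⊆ {⌊X⌋₊} := fun N hN => by
    simp only [A, conductors, Finset.mem_sdiff, Finset.mem_filter, Finset.mem_Ioc,
      Finset.mem_Icc] at hN
    have hle : ⌊X⌋₊ ≤ N := (Nat.floor_le_ceil X).trans hN.1.1.1
    have hge : ¬ ⌊X⌋₊ < N := fun h => hN.2 ⟨⟨h, hN.1.1.2⟩, hN.1.2⟩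
    rw [Finset.mem_singleton]
    lia
  rw [← Finset.sum_sdiff hsub, add_sub_cancel_right,
    abs_of_nonneg (Finset.sum_nonneg fun N _ => by positivity)]
  refine (Finset.sum_le_sum_of_subset_of_nonneg hdiff fun N _ _ => by positivity).trans ?_
  rw [Finset.sum_singleton]
  exact totient_div_le_one _

lemma coprime_of_mem_S (hN : N ∈ S) (hq : q.Prime) (hNq : N < q ^ 2) (hne : N ≠ q) :
    q.Coprime N := by
  refine (Nat.Prime.coprime_iff_not_dvd hq).2 fun hdvd => ?_
  rcases hN.2.2 with h | h
  · exact hne ((Nat.prime_dvd_prime_iff_eq hq h).1 hdvd).symm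
  · exact hNq.not_ge (Nat.le_of_dvd hN.1 (h.2 q hq hdvd))

lemma signSum_eq_zero (s : ℂ) (hq : ¬ q.Coprime N) : signSum s q N = 0 :=
  finsum_mem_eq_zero_of_forall_eq_zero fun χ _ => by
    rw [MulChar.map_nonunit _ (mt (ZMod.isUnit_iff_coprime q N).1 hq), zero_div]

lemma norm_eq_one_of_sign (hs : s = 1 ∨ s = -1) : ‖s‖ = 1 := by
  rcases hs with rfl | rfl <;> simp

lemma norm_totient_div_mul_density_le (hs : ‖s‖ ≤ 1) (N : ℕ) (u : ℝ) :
    ‖(N.totient : ℂ) / N * density s u‖ ≤ 1 := by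
  rw [norm_mul, norm_div, Complex.norm_natCast, Complex.norm_natCast]
  exact mul_le_one₀ (totient_div_le_one N) (norm_nonneg _) (norm_density_le hs u)

lemma norm_signSum_sub_le_of_mem_S (hs : s = 1 ∨ s = -1) (hN : N ∈ S) (hq : q.Prime)
    (hNq : N < q ^ 2) :
    ‖signSum s q N - N.totient / N * density s ((q : ℝ) / N)‖ ≤
      1 / N + if N = q then 1 else 0 := by
  have : NeZero N := ⟨hN.1.ne'⟩
  rcases eq_or_ne N q with rfl | hne
  · rw [signSum_eq_zero s (by simpa using hq.ne_one), zero_sub, norm_neg, if_pos rfl]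
    exact (norm_totient_div_mul_density_le (norm_eq_one_of_sign hs).le _ _).trans
      (le_add_of_nonneg_left (by positivity))
  · rw [if_neg hne, add_zero]
    exact norm_signSum_sub_le hN.2.2 (coprime_of_mem_S hN hq hNq hne) hs

lemma norm_sum_signSum_sub_sum_density_le (hs : s = 1 ∨ s = -1) (hX : 0 < X) (hXY : X ≤ Y)
    (hq : q.Prime) (hYq : Y < (q : ℝ) ^ 2) :
    ‖∑ N ∈ conductors X Y, signSum s q N
      - ∑ N ∈ conductors X Y, (N.totient : ℂ) / N * density s ((q : ℝ) / N)‖ ≤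
        (Y - X + 1) / X + 1 := by
  rw [← Finset.sum_sub_distrib]
  calc _ ≤ ∑ N ∈ conductors X Y, (1 / X + if N = q then 1 else 0) := by
        refine norm_sum_le_of_le _ fun N hN => ?_
        obtain ⟨hXN, hNY, hNS⟩ := mem_conductors.1 hN
        refine (norm_signSum_sub_le_of_mem_S hs hNS hq ?_).trans (by gcongr)
        exact_mod_cast hNY.trans_lt hYq
    _ = (conductors X Y).card / X + if q ∈ conductors X Y then 1 else 0 := by
        rw [Finset.sum_add_distrib, Finset.sum_const, nsmul_eq_mul, Finset.sum_ite_eq',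
          mul_one_div]
    _ ≤ (Y - X + 1) / X + 1 := by
        gcongr
        · exact card_conductors_le hX.le hXY
        · split_ifs <;> norm_num

lemma norm_sum_density_sub_mul_density_le (hs : ‖s‖ ≤ 1) (hXY : X ≤ Y) (hε : 0 ≤ ε)
    (hdensity : ∀ N ∈ conductors X Y, ‖density s ((q : ℝ) / N) - density s y‖ ≤ ε) :
    ‖∑ N ∈ conductors X Y, (N.totient : ℂ) / N * density s ((q : ℝ) / N)
      - (f Y - f X : ℝ) * density s y‖ ≤ ε * (f Y - f X + 1) + 1 := by
  have hmass := abs_sum_conductors_sub_le hXY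
  set W := ∑ N ∈ conductors X Y, (N.totient : ℝ) / N with hW
  have hvary : ‖∑ N ∈ conductors X Y, (N.totient : ℂ) / N * density s ((q : ℝ) / N)
      - W * density s y‖ ≤ ε * W := by
    rw [hW, Complex.ofReal_sum, Finset.sum_mul, ← Finset.sum_sub_distrib, Finset.mul_sum]
    refine norm_sum_le_of_le _ fun N hN => ?_
    push_cast
    rw [← mul_sub, norm_mul, norm_div, Complex.norm_natCast, Complex.norm_natCast, mul_comm]
    gcongr
    exact hdensity N hN
  have hnormalize : ‖(W : ℂ) * density s y - (f Y - f X : ℝ) * density s y‖ ≤ 1 := by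
    rw [← sub_mul, ← Complex.ofReal_sub, norm_mul, Complex.norm_real, Real.norm_eq_abs]
    exact mul_le_one₀ hmass (norm_nonneg _) (norm_density_le hs y)
  have hWle : ε * W ≤ ε * (f Y - f X + 1) := by
    gcongr
    linarith [(abs_le.1 hmass).2]
  exact (norm_sub_le_norm_sub_add_norm_sub _ _ _).trans
    (add_le_add (hvary.trans hWle) hnormalize)

lemma eventually_norm_density_div_sub_le {Y q : ℝ → ℝ} (s : ℂ) (hq0 : ∀ X, 0 ≤ q X)
    (hqX : Tendsto (fun X => q X / X) atTop (𝓝 y)) (hqY : Tendsto (fun X => q X / Y X) atTop (𝓝 y))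
    (hε : 0 < ε) :
    ∀ᶠ X in atTop, ∀ N ∈ Set.Icc X (Y X), ‖density s (q X / N) - density s y‖ ≤ ε := by
  obtain ⟨r, hr, hclose⟩ :=
    Metric.continuousAt_iff.1 (continuous_density s).continuousAt ε hε
  filter_upwards [eventually_gt_atTop 0, (tendsto_order.1 hqX).2 (y + r) (by linarith),
    (tendsto_order.1 hqY).1 (y - r) (by linarith)] with X hX hupper hlower N hN
  have hN0 : 0 < N := hX.trans_le hN.1
  have hleX : q X / N ≤ q X / X := div_le_div_of_nonneg_left (hq0 X) hX hN.1
  have hleN : q X / Y X ≤ q X / N := div_le_div_of_nonneg_left (hq0 X) hN0 hN.2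
  rw [← dist_eq_norm]
  exact (hclose (abs_lt.2 ⟨by linarith, by linarith⟩)).le

lemma eventually_lt_sq {Y q : ℝ → ℝ} (hy : 0 < y) (hqX : Tendsto (fun X => q X / X) atTop (𝓝 y))
    (hY : ∀ᶠ X in atTop, Y X ≤ 2 * X) : ∀ᶠ X in atTop, Y X < q X ^ 2 := by
  filter_upwards [(tendsto_order.1 hqX).1 (y / 2) (by linarith), hY,
    eventually_gt_atTop (8 / y ^ 2), eventually_gt_atTop 0] with X hq hYX hlarge hX
  rw [lt_div_iff₀ hX] at hq
  rw [div_lt_iff₀ (by positivity)] at hlarge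
  calc Y X ≤ 8 * X / 4 := by linarith
    _ < X * y ^ 2 * X / 4 := by gcongr
    _ = (y / 2 * X) ^ 2 := by ring
    _ < q X ^ 2 := by gcongr

theorem tendsto_average_signSum (hs : s = 1 ∨ s = -1) {Y : ℝ → ℝ} {q : ℝ → ℕ} (hy : 0 < y)
    (hXY : ∀ᶠ X in atTop, X ≤ Y X) (hY : Tendsto (fun X => Y X / X) atTop (𝓝 1))
    (hf : Tendsto (fun X => f (Y X) - f X) atTop atTop) (hq : ∀ X, (q X).Prime)
    (hqX : Tendsto (fun X => (q X : ℝ) / X) atTop (𝓝 y)) :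
    Tendsto (fun X => 1 / ((f (Y X) - f X : ℝ) : ℂ) * ∑ N ∈ conductors X (Y X), signSum s (q X) N)
      atTop (𝓝 (density s y)) := by
  have hqY : Tendsto (fun X => (q X : ℝ) / Y X) atTop (𝓝 y) := by
    rw [← div_one y]
    refine (hqX.div hY one_ne_zero).congr' ?_
    filter_upwards [eventually_ne_atTop 0] with X hX
    exact div_div_div_cancel_right₀ hX _ _
  have hY2 : ∀ᶠ X in atTop, Y X ≤ 2 * X := by
    filter_upwards [(tendsto_order.1 hY).2 2 one_lt_two, eventually_gt_atTop 0] with X h hX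
    exact ((div_lt_iff₀ hX).1 h).le
  rw [Metric.tendsto_nhds]
  intro ε hε
  have hε3 : 0 < ε / 3 := by positivity
  filter_upwards [hf.eventually_gt_atTop 1, hf.eventually_gt_atTop (12 / ε), hXY, hY2,
    eventually_ge_atTop 1, eventually_lt_sq hy hqX hY2,
    eventually_norm_density_div_sub_le s (fun X => (q X).cast_nonneg) hqX hqY hε3]
    with X hf1 hfε hXY hY2 hX hYq hdensity
  have hX0 : 0 < X := by linarith
  have hf0 : ((f (Y X) - f X : ℝ) : ℂ) ≠ 0 := Complex.ofReal_ne_zero.2 (by linarith)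
  have hcard : (Y X - X + 1) / X ≤ 2 := by
    rw [div_le_iff₀ hX0]
    linarith
  have hchar := norm_sum_signSum_sub_sum_density_le hs hX0 hXY (hq X) hYq
  have hmass := norm_sum_density_sub_mul_density_le (q := q X) (norm_eq_one_of_sign hs).le hXY
    hε3.le fun N hN => hdensity N
      ⟨(mem_conductors.1 hN).1, (mem_conductors.1 hN).2.1⟩
  rw [dist_eq_norm, one_div_mul_eq_div, div_sub' hf0, norm_div, Complex.norm_real,
    Real.norm_of_nonneg (by linarith), div_lt_iff₀ (by linarith)]
  refine ((norm_sub_le_norm_sub_add_norm_sub _ _ _).trans (add_le_add hchar hmass)).trans_lt ?_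
  rw [div_lt_iff₀ hε] at hfε
  nlinarith

lemma tendsto_nextPrime_mul_div (hy : 0 < y) :
    Tendsto (fun X : ℝ => (nextPrime (y * X) : ℝ) / X) atTop (𝓝 y) := by
  rw [← mul_one y]
  refine ((tendsto_nextPrime_div.comp (tendsto_id.const_mul_atTop hy)).const_mul y).congr
    fun X => ?_
  simp only [Function.comp_apply, id, mul_one]
  rw [mul_div_assoc', mul_div_mul_left _ _ hy.ne']

lemma tendsto_add_rpow_div {δ : ℝ} (hδ : δ < 1) :
    Tendsto (fun X : ℝ => (X + X ^ δ) / X) atTop (𝓝 1) := by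
  rw [← add_zero 1]
  refine ((tendsto_rpow_neg_atTop (sub_pos.2 hδ)).const_add 1).congr' ?_
  filter_upwards [eventually_gt_atTop 0] with X hX
  rw [add_div, div_self hX.ne', ← Real.rpow_sub_one hX.ne', neg_sub]

theorem tendsto_QS_signPrimitive (hs : s = 1 ∨ s = -1) {δ : ℝ} (hδ : δ ∈ Set.Ioo (1 / 2 : ℝ) 1)
    (hy : 0 < y) : Tendsto (fun X => QS (signPrimitive s) y X δ) atTop (𝓝 (density s y)) := by
  refine tendsto_average_signSum hs hy ?_ (tendsto_add_rpow_div hδ.2)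
    (tendsto_f_add_rpow_sub_f hδ) (fun X => (nextPrime_spec (y * X)).1)
    (tendsto_nextPrime_mul_div hy)
  filter_upwards [eventually_ge_atTop 0] with X hX
  exact le_add_of_nonneg_right (Real.rpow_nonneg hX δ)

end Averages

end DirichletMurmuration

theorem mainTheorem6_general (δ : ℝ) (hδ : δ ∈ Set.Ioo (1 / 2 : ℝ) 1) (y : ℝ) (hy : 0 < y) :
    Tendsto (fun X : ℝ => DirichletMurmuration.QS DirichletMurmuration.evenPrimitive y X δ)
        atTop (𝓝 ((Real.cos (2 * Real.pi * y) : ℝ) : ℂ)) ∧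
      Tendsto (fun X : ℝ => DirichletMurmuration.QS DirichletMurmuration.oddPrimitive y X δ)
        atTop (𝓝 (-Complex.I * ((Real.sin (2 * Real.pi * y) : ℝ) : ℂ))) := by
  rw [← DirichletMurmuration.density_one, ← DirichletMurmuration.density_neg_one]
  exact ⟨DirichletMurmuration.tendsto_QS_signPrimitive (Or.inl rfl) hδ hy,
    DirichletMurmuration.tendsto_QS_signPrimitive (Or.inr rfl) hδ hy⟩

theorem mainTheorem6 (hRH : RiemannHypothesis) (δ : ℝ) (hδ : δ ∈ Set.Ioo (1 / 2 : ℝ) 1)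
    (y : ℝ) (hy : 0 < y) :
    Tendsto (fun X : ℝ => DirichletMurmuration.QS DirichletMurmuration.evenPrimitive y X δ)
        atTop (𝓝 ((Real.cos (2 * Real.pi * y) : ℝ) : ℂ)) ∧
      Tendsto (fun X : ℝ => DirichletMurmuration.QS DirichletMurmuration.oddPrimitive y X δ)
        atTop (𝓝 (-Complex.I * ((Real.sin (2 * Real.pi * y) : ℝ) : ℂ))) :=
  mainTheorem6_general δ hδ y hy
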